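/- Let $d\ge 1$, let $n=\binom{d+1}{2}$, and let $\mathcal S^d$ be the space of real symmetric $d\times d$ matrices. For $Q\in\mathcal S^d$ and $x\in\mathbb R^d$ write $Q[x]=x^tQx$. If $Q$ is positive definite, its arithmetical minimum is $\lambda_1(Q)=\min_{x\in\mathbb Z^d\setminus\{0\}}Q[x]$, and its set of minimal vectors is $\operatorname{Min}Q=\{x\in\mathbb Z^d: Q[x]=\lambda_1(Q)\}$. A positive definite $Q$ is called perfect if $Q'=Q$ is the only $Q'\in\mathcal S^d$ such that $Q'[x]=\lambda_1(Q)$ for all $x\in\operatorname{Min}Q$. It is called integral if all its matrix entries are integers; an integral $Q$ is called primitive if the greatest common divisor of its entries is $1$. Let $Q\in\mathcal S^d$ be a primitive integral perfect positive definite form. Then $$\lambda_1(Q)\;\le\;2^{-(n+d/2)}\,\bigl(d^3(d+7)\bigr)^{n/2}.$$ -/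

import Mathlib

open scoped Matrix

namespace PerfectForm

/-- The value `Q[x] = xᵗ Q x` of the quadratic form with real matrix `Q` at an integral vector. -/
def eval {d : ℕ} (Q : Matrix (Fin d) (Fin d) ℝ) (x : Fin d → ℤ) : ℝ :=
  (fun i => (x i : ℝ)) ⬝ᵥ (Q *ᵥ fun i => (x i : ℝ))

/-- The arithmetical minimum `λ₁(Q) = min {Q[x] : x ∈ ℤᵈ, x ≠ 0}`. For positive definite `Q` and
`d ≥ 1` the infimum below is attained. -/
noncomputable def arithMin {d : ℕ} (Q : Matrix (Fin d) (Fin d) ℝ) : ℝ :=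
  sInf {r : ℝ | ∃ x : Fin d → ℤ, x ≠ 0 ∧ eval Q x = r}

/-- The set of minimal vectors of `Q`. -/
def minVectors {d : ℕ} (Q : Matrix (Fin d) (Fin d) ℝ) : Set (Fin d → ℤ) :=
  {x | eval Q x = arithMin Q}

/-- A positive definite quadratic form `Q` is perfect if `Q' = Q` is the only real symmetric
solution of the linear system `Q'[x] = λ₁(Q)`, `x` ranging over the minimal vectors of `Q`. -/
def IsPerfect {d : ℕ} (Q : Matrix (Fin d) (Fin d) ℝ) : Prop :=
  Q.PosDef ∧ ∀ Q' : Matrix (Fin d) (Fin d) ℝ, Q'.IsSymm →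
    (∀ x ∈ minVectors Q, eval Q' x = arithMin Q) → Q' = Q

/-- An integral matrix is primitive if its entries have no common divisor other than `±1`
(so the empty matrix, `d = 0`, is not primitive). -/
def IsPrimitive {d : ℕ} (Q : Matrix (Fin d) (Fin d) ℤ) : Prop :=
  ∀ k : ℤ, (∀ i j, k ∣ Q i j) → IsUnit k

/-- The real form given by an integral matrix. -/
def toReal {d : ℕ} (Q : Matrix (Fin d) (Fin d) ℤ) : Matrix (Fin d) (Fin d) ℝ :=
  Q.map (fun a : ℤ => (a : ℝ))

end PerfectForm

namespace PerfectForm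

/-- Index set of the coordinates of a symmetric `d × d` matrix. -/
abbrev UpperIndex (d : ℕ) : Type := {p : Fin d × Fin d // p.1 ≤ p.2}

theorem card_upperIndex (d : ℕ) : Fintype.card (UpperIndex d) = (d + 1).choose 2 := by
  rw [← Fintype.card_congr (Sym2.sortEquiv (α := Fin d)), Sym2.card, Fintype.card_fin]

@[to_additive]
theorem prod_prod_eq_prod_upperIndex {d : ℕ} {α : Type*} [CommMonoid α] (F : Fin d → Fin d → α) :
    ∏ i, ∏ j, F i j = ∏ p : UpperIndex d,
      if p.1.1 = p.1.2 then F p.1.1 p.1.2 else F p.1.1 p.1.2 * F p.1.2 p.1.1 := by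
  have h1 : ∏ p : UpperIndex d,
      (if p.1.1 = p.1.2 then F p.1.1 p.1.2 else F p.1.1 p.1.2 * F p.1.2 p.1.1) =
      ∏ p : Fin d × Fin d, if p.1 ≤ p.2 then
        (if p.1 = p.2 then F p.1 p.2 else F p.1 p.2 * F p.2 p.1) else 1 := by
    rw [← Finset.prod_filter]
    exact (Finset.prod_subtype (Finset.univ.filter fun p : Fin d × Fin d => p.1 ≤ p.2)
      (by simp) (fun p => if p.1 = p.2 then F p.1 p.2 else F p.1 p.2 * F p.2 p.1)).symm
  have h2 : ∀ i j : Fin d, (if i ≤ j then (if i = j then F i j else F i j * F j i) else 1) =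
      (if i ≤ j then F i j else 1) * (if i < j then F j i else 1) := by
    intro i j
    rcases lt_trichotomy i j with h | h | h
    · simp [h, h.le, h.ne]
    · simp [h]
    · simp [h.not_ge, h.not_gt]
  rw [h1, Fintype.prod_prod_type]
  simp only [h2, Finset.prod_mul_distrib]
  rw [Finset.prod_comm (f := fun i j : Fin d => if i < j then F j i else 1)]
  simp only [← Finset.prod_mul_distrib]
  refine Finset.prod_congr rfl fun i _ => Finset.prod_congr rfl fun j _ => ?_
  rcases lt_or_ge j i with h | h
  · simp [h, h.not_ge]
  · simp [h, h.not_gt]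

/-- The multiplicity with which a coordinate occurs in a symmetric matrix. -/
def weight {d : ℕ} (p : UpperIndex d) : ℕ := if p.1.1 = p.1.2 then 1 else 2

theorem prod_weight_mul (d : ℕ) :
    (∏ p : UpperIndex d, weight p) * 2 ^ d = 2 ^ (d + 1).choose 2 := by
  have h1 : ∏ p : UpperIndex d, (if p.1.1 = p.1.2 then 2 else 1) = 2 ^ d := by
    have := prod_prod_eq_prod_upperIndex (d := d) (fun i j => if i = j then 2 else 1)
    simp only [Finset.prod_ite_eq, Finset.mem_univ, if_true, Finset.prod_const,
      Finset.card_univ, Fintype.card_fin] at this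
    rw [this]
    refine Finset.prod_congr rfl fun p _ => ?_
    by_cases h : p.1.1 = p.1.2
    · simp [h]
    · simp [h, Ne.symm h]
  rw [← h1, ← Finset.prod_mul_distrib, ← card_upperIndex, ← Finset.card_univ, ← Finset.prod_const]
  refine Finset.prod_congr rfl fun p _ => ?_
  unfold weight
  split_ifs <;> rfl

theorem sum_symm_eq_sum_weight {d : ℕ} {R : Type*} [CommSemiring R] (F : Fin d → Fin d → R)
    (hF : ∀ i j, F i j = F j i) :
    ∑ i, ∑ j, F i j = ∑ p : UpperIndex d, (weight p : R) * F p.1.1 p.1.2 := by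
  rw [sum_sum_eq_sum_upperIndex]
  refine Finset.sum_congr rfl fun p _ => ?_
  unfold weight
  split_ifs with h
  · simp
  · rw [hF p.1.2 p.1.1]
    push_cast
    ring

theorem prod_upperIndex_mul {d : ℕ} {R : Type*} [CommMonoid R] (b : Fin d → R) :
    ∏ p : UpperIndex d, b p.1.1 * b p.1.2 = (∏ i, b i) ^ (d + 1) := by
  have := prod_prod_eq_prod_upperIndex (d := d) (fun i j => b i * if i = j then b i else 1)
  simp only [Finset.prod_mul_distrib, Finset.prod_ite_eq, Finset.mem_univ, if_true,
    Finset.prod_const, Finset.card_univ, Fintype.card_fin, Finset.prod_pow] at this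
  rw [pow_succ, this]
  refine Finset.prod_congr rfl fun p _ => ?_
  by_cases h : p.1.1 = p.1.2
  · simp [h]
  · simp [h, Ne.symm h]

/-- The matrix whose rows are the coordinates of the rank one matrices `xₖ xₖᵗ`. -/
def veronese {d : ℕ} {ι R : Type*} [Mul R] (x : ι → Fin d → R) : Matrix ι (UpperIndex d) R :=
  Matrix.of fun k p => x k p.1.1 * x k p.1.2

theorem sum_weight_veronese {d : ℕ} {ι R : Type*} [CommSemiring R] (x : ι → Fin d → R) (k l : ι) :
    ∑ p, (weight p : R) * (veronese x k p * veronese x l p) = (x k ⬝ᵥ x l) ^ 2 := by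
  have := sum_symm_eq_sum_weight (fun i j => (x k i * x l i) * (x k j * x l j))
    (fun i j => mul_comm _ _)
  rw [← Finset.sum_mul_sum, ← sq] at this
  rw [dotProduct, this]
  refine Finset.sum_congr rfl fun p _ => ?_
  simp only [veronese, Matrix.of_apply]
  ring

theorem det_veronese_sq {d : ℕ} {R : Type*} [CommRing R] (x : UpperIndex d → Fin d → R) :
    (veronese x).det ^ 2 * ∏ p : UpperIndex d, (weight p : R) =
      (Matrix.of fun k l => (x k ⬝ᵥ x l) ^ 2).det := by
  have : (Matrix.of fun k l => (x k ⬝ᵥ x l) ^ 2) =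
      veronese x * Matrix.diagonal (fun p : UpperIndex d => (weight p : R)) * (veronese x)ᵀ := by
    ext k l
    rw [Matrix.of_apply, ← sum_weight_veronese, Matrix.mul_apply]
    refine Finset.sum_congr rfl fun p _ => ?_
    rw [Matrix.mul_diagonal, Matrix.transpose_apply]
    ring
  rw [this, Matrix.det_mul, Matrix.det_mul, Matrix.det_diagonal, Matrix.det_transpose]
  ring

theorem prod_weight_pos (d : ℕ) : (0 : ℝ) < ∏ p : UpperIndex d, (weight p : ℝ) := by
  refine Finset.prod_pos fun p _ => ?_
  unfold weight
  split_ifs <;> norm_num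

theorem det_veronese_orthogonal {d : ℕ} (x : UpperIndex d → Fin d → ℝ)
    (U : Matrix (Fin d) (Fin d) ℝ) (hU : Uᵀ * U = 1) :
    (veronese fun k => U *ᵥ x k).det ^ 2 = (veronese x).det ^ 2 := by
  refine mul_right_cancel₀ (prod_weight_pos d).ne' ?_
  rw [det_veronese_sq, det_veronese_sq]
  congr! 5 with k l
  rw [Matrix.dotProduct_mulVec, Matrix.vecMul_mulVec, hU, Matrix.vecMul_one]

theorem det_veronese_diagonal {d : ℕ} {R : Type*} [CommRing R] (x : UpperIndex d → Fin d → R)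
    (s : Fin d → R) :
    (veronese fun k => Matrix.diagonal s *ᵥ x k).det =
      (veronese x).det * (∏ i, s i) ^ (d + 1) := by
  rw [← prod_upperIndex_mul, ← Matrix.det_diagonal, ← Matrix.det_mul]
  congr 1
  ext k p
  simp only [veronese, Matrix.of_apply, Matrix.mul_diagonal, Matrix.mulVec_diagonal]
  ring

/-- Hadamard's determinant inequality. -/
theorem abs_det_le_prod_sqrt {ι : Type*} [Fintype ι] [DecidableEq ι] (N : Matrix ι ι ℝ) :
    |N.det| ≤ ∏ k, √(∑ p, N k p ^ 2) := by
  let e := Fintype.equivFin ι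
  let n := Fintype.card ι
  let b := EuclideanSpace.basisFun (Fin n) ℝ
  have : Fact (Module.finrank ℝ (EuclideanSpace ℝ (Fin n)) = n) := ⟨by simp⟩
  let v : Fin n → EuclideanSpace ℝ (Fin n) := fun k =>
    WithLp.toLp 2 fun j => N (e.symm k) (e.symm j)
  have h := b.toBasis.orientation.abs_volumeForm_apply_le v
  rw [Orientation.volumeForm_robust _ b rfl] at h
  have hdet : b.toBasis.det v = N.det := by
    rw [Module.Basis.det_apply, ← Matrix.det_transpose, ← Matrix.det_submatrix_equiv_self e.symm N]
    congr 1
  rw [hdet] at h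
  refine h.trans_eq ?_
  rw [← e.prod_comp]
  refine Finset.prod_congr rfl fun k _ => ?_
  rw [EuclideanSpace.norm_eq, ← e.sum_comp]
  simp [v]

theorem det_veronese_sq_mul_le {d : ℕ} (x : UpperIndex d → Fin d → ℝ) :
    (veronese x).det ^ 2 * ∏ p : UpperIndex d, (weight p : ℝ) ≤ ∏ k, (x k ⬝ᵥ x k) ^ 2 := by
  have h := abs_det_le_prod_sqrt
    (veronese x * Matrix.diagonal fun p : UpperIndex d => √(weight p : ℝ))
  have h2 := pow_le_pow_left₀ (abs_nonneg _) h 2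
  rw [sq_abs, Matrix.det_mul, Matrix.det_diagonal, mul_pow, ← Finset.prod_pow,
    ← Finset.prod_pow] at h2
  simp only [Nat.cast_nonneg, Real.sq_sqrt] at h2
  refine h2.trans_eq (Finset.prod_congr rfl fun k _ => ?_)
  rw [Real.sq_sqrt (Finset.sum_nonneg fun _ _ => sq_nonneg _), ← sum_weight_veronese]
  refine Finset.sum_congr rfl fun p _ => ?_
  rw [Matrix.mul_diagonal, mul_pow, Real.sq_sqrt (Nat.cast_nonneg _)]
  ring

theorem exists_diagonal_mul_orthogonal {d : ℕ} {Q : Matrix (Fin d) (Fin d) ℝ} (hQ : Q.PosDef) :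
    ∃ (s : Fin d → ℝ) (U : Matrix (Fin d) (Fin d) ℝ), (∀ i, 0 < s i) ∧ Uᵀ * U = 1 ∧
      Q = (Matrix.diagonal s * U)ᵀ * (Matrix.diagonal s * U) := by
  have hev := hQ.eigenvalues_pos
  let V : Matrix (Fin d) (Fin d) ℝ := hQ.isHermitian.eigenvectorUnitary
  have hV : V * star V = 1 := Unitary.coe_mul_star_self hQ.isHermitian.eigenvectorUnitary
  rw [Matrix.star_eq_conjTranspose, Matrix.conjTranspose_eq_transpose_of_trivial] at hV
  refine ⟨fun i => √(hQ.isHermitian.eigenvalues i), Vᵀ, fun i => Real.sqrt_pos.2 (hev i),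
    by rwa [Matrix.transpose_transpose], ?_⟩
  have hs := hQ.isHermitian.spectral_theorem
  rw [Unitary.conjStarAlgAut_apply] at hs
  change Q = V * _ * star V at hs
  rw [Matrix.star_eq_conjTranspose, Matrix.conjTranspose_eq_transpose_of_trivial] at hs
  rw [Matrix.transpose_mul, Matrix.transpose_transpose, Matrix.diagonal_transpose,
    Matrix.mul_assoc, ← Matrix.mul_assoc (Matrix.diagonal _), Matrix.diagonal_mul_diagonal]
  simp only [Real.mul_self_sqrt (hev _).le]
  rw [← Matrix.mul_assoc]
  exact hs

/-- The real vector underlying an integral vector. -/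
def realVec {d : ℕ} (x : Fin d → ℤ) : Fin d → ℝ := fun i => (x i : ℝ)

theorem eval_transpose_mul_self {d : ℕ} (B : Matrix (Fin d) (Fin d) ℝ) (x : Fin d → ℤ) :
    eval (Bᵀ * B) x = (B *ᵥ realVec x) ⬝ᵥ (B *ᵥ realVec x) := by
  rw [Matrix.dotProduct_mulVec, Matrix.vecMul_mulVec, ← Matrix.dotProduct_mulVec]
  rfl

theorem eval_eq_sum_weight {d : ℕ} {Q : Matrix (Fin d) (Fin d) ℝ} (hQ : Q.IsSymm)
    (x : Fin d → ℤ) :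
    eval Q x = ∑ p : UpperIndex d, (weight p : ℝ) * Q p.1.1 p.1.2 *
      ((x p.1.1 : ℝ) * (x p.1.2 : ℝ)) := by
  have := sum_symm_eq_sum_weight (fun i j => Q i j * ((x i : ℝ) * (x j : ℝ)))
    (fun i j => by rw [hQ.apply i j, mul_comm (x i : ℝ)])
  simp only [mul_assoc]
  rw [← this]
  simp only [eval, dotProduct, Matrix.mulVec, Finset.mul_sum]
  refine Finset.sum_congr rfl fun i _ => Finset.sum_congr rfl fun j _ => ?_
  ring

theorem eval_pos {d : ℕ} {Q : Matrix (Fin d) (Fin d) ℝ} (hQ : Q.PosDef) {x : Fin d → ℤ}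
    (hx : x ≠ 0) : 0 < eval Q x := by
  have h : (fun i => (x i : ℝ)) ≠ 0 := fun h => hx (funext fun i => by
    simpa using congrFun h i)
  simpa [eval] using hQ.dotProduct_mulVec_pos h

theorem arithMin_le_eval {d : ℕ} {Q : Matrix (Fin d) (Fin d) ℝ} (hQ : Q.PosDef) {x : Fin d → ℤ}
    (hx : x ≠ 0) : arithMin Q ≤ eval Q x :=
  csInf_le ⟨0, by rintro _ ⟨y, hy, rfl⟩; exact (eval_pos hQ hy).le⟩ ⟨x, hx, rfl⟩

theorem arithMin_nonneg {d : ℕ} {Q : Matrix (Fin d) (Fin d) ℝ} (hQ : Q.PosDef) :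
    0 ≤ arithMin Q :=
  Real.sInf_nonneg (by rintro _ ⟨y, hy, rfl⟩; exact (eval_pos hQ hy).le)

/-- The rank one matrices of the minimal vectors of a perfect form span the symmetric matrices. -/
theorem IsPerfect.exists_det_veronese_ne_zero {d : ℕ} {Q : Matrix (Fin d) (Fin d) ℝ}
    (hQ : IsPerfect Q) :
    ∃ x : UpperIndex d → Fin d → ℤ, (∀ k, x k ∈ minVectors Q) ∧ (veronese x).det ≠ 0 := by
  let m : (Fin d → ℤ) → UpperIndex d → ℝ := fun x p => (x p.1.1 : ℝ) * (x p.1.2 : ℝ)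
  have hsymm : Q.IsSymm := by
    have := hQ.1.isHermitian
    rwa [Matrix.IsHermitian, Matrix.conjTranspose_eq_transpose_of_trivial] at this
  have hspan : Submodule.span ℝ (m '' minVectors Q) = ⊤ := by
    by_contra hne
    obtain ⟨f, hf0, hf⟩ := Submodule.exists_le_ker_of_lt_top _ (lt_top_iff_ne_top.2 hne)
    let c : UpperIndex d → ℝ := fun p => f (Pi.single p 1)
    let a : Fin d → Fin d → ℝ := fun i j => if h : i ≤ j then c ⟨(i, j), h⟩ / weight ⟨(i, j), h⟩
      else 0
    let S : Matrix (Fin d) (Fin d) ℝ := Matrix.of fun i j => a (min i j) (max i j)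
    have hS : S.IsSymm := by
      ext i j
      simp [S, min_comm, max_comm]
    have hw : ∀ p : UpperIndex d, (weight p : ℝ) ≠ 0 := by
      intro p
      unfold weight
      split_ifs <;> norm_num
    have hSp : ∀ p : UpperIndex d, (weight p : ℝ) * S p.1.1 p.1.2 = c p := by
      intro p
      have := p.2
      simp only [S, a, Matrix.of_apply, min_eq_left this, max_eq_right this, dif_pos this]
      exact mul_div_cancel₀ _ (hw p)
    have hfm : ∀ v, f v = ∑ p, c p * v p := by
      intro v
      conv_lhs => rw [← Finset.univ_sum_single v, map_sum]
      refine Finset.sum_congr rfl fun p _ => ?_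
      rw [mul_comm, ← smul_eq_mul, ← map_smul, ← Pi.single_smul, smul_eq_mul, mul_one]
    have hz : ∀ x ∈ minVectors Q, eval (Q + S) x = arithMin Q := by
      intro x hx
      have h0 : f (m x) = 0 := hf (Submodule.subset_span ⟨x, hx, rfl⟩)
      have hSx : eval S x = 0 := by
        rw [eval_eq_sum_weight hS, ← h0, hfm]
        exact Finset.sum_congr rfl fun p _ => by rw [hSp]
      have hadd : eval (Q + S) x = eval Q x + eval S x := by
        simp only [eval, Matrix.add_mulVec, dotProduct_add]
      rw [hadd, hSx, add_zero]
      exact hx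
    have hS0 : S = 0 := by simpa using hQ.2 _ (hsymm.add hS) hz
    refine hf0 (LinearMap.ext fun v => ?_)
    rw [hfm]
    refine Finset.sum_eq_zero fun p _ => ?_
    rw [← hSp, hS0]
    simp
  obtain ⟨g, hg, -, hind⟩ := Submodule.exists_fun_fin_finrank_span_eq ℝ (m '' minVectors Q)
  have hcard : Module.finrank ℝ (Submodule.span ℝ (m '' minVectors Q)) =
      Fintype.card (UpperIndex d) := by
    rw [hspan, finrank_top, Module.finrank_pi]
  let e : UpperIndex d ≃ Fin (Module.finrank ℝ (Submodule.span ℝ (m '' minVectors Q))) :=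
    Fintype.equivOfCardEq (by rw [Fintype.card_fin, hcard])
  choose y hy hyg using hg
  refine ⟨fun k => y (e k), fun k => hy _, fun h => ?_⟩
  have hrow : (veronese fun k => realVec (y (e k))).row = g ∘ e := by
    ext k p
    exact congrFun (hyg (e k)) p
  have hunit : IsUnit (veronese fun k => realVec (y (e k))) := by
    rw [← Matrix.linearIndependent_rows_iff_isUnit, hrow]
    exact hind.comp _ e.injective
  have hmap : veronese (fun k => realVec (y (e k))) =
      (Int.castRingHom ℝ).mapMatrix (veronese fun k => y (e k)) := by
    ext k p
    simp [veronese, realVec]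
  rw [Matrix.isUnit_iff_isUnit_det, hmap, ← RingHom.map_det, h, map_zero] at hunit
  exact not_isUnit_zero hunit

theorem IsPrimitive.dvd_of_dvd_mul {d : ℕ} {Q : Matrix (Fin d) (Fin d) ℤ} (hQ : IsPrimitive Q)
    {l c : ℤ} (h : ∀ i j, l ∣ c * Q i j) : l ∣ c := by
  have hunit : IsUnit (Finset.univ.gcd fun p : Fin d × Fin d => Q p.1 p.2) :=
    hQ _ fun i j => Finset.gcd_dvd (Finset.mem_univ (i, j))
  have hdvd : l ∣ Finset.univ.gcd fun p : Fin d × Fin d => c * Q p.1 p.2 :=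
    Finset.dvd_gcd fun p _ => h p.1 p.2
  rw [(Finset.gcd_mul_left' (s := Finset.univ) (f := fun p : Fin d × Fin d => Q p.1 p.2)
    c).dvd_iff_dvd_right] at hdvd
  exact hunit.dvd_mul_right.1 hdvd

/-- Cramer's rule for a primitive integral form that takes the same value at all members of a
family of vectors whose rank one matrices are independent. -/
theorem IsPrimitive.dvd_two_mul_det_veronese {d : ℕ} {Q : Matrix (Fin d) (Fin d) ℤ}
    (hQ : IsPrimitive Q) (hsymm : Q.IsSymm) (x : UpperIndex d → Fin d → ℤ) {l : ℤ}
    (hl : ∀ k, eval (toReal Q) (x k) = l) : l ∣ 2 * (veronese x).det := by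
  let a : UpperIndex d → ℤ := fun p => weight p * Q p.1.1 p.1.2
  have hsys : veronese x *ᵥ a = l • (1 : UpperIndex d → ℤ) := by
    ext k
    have h := hl k
    have hsymm' : (toReal Q).IsSymm := hsymm.map _
    rw [eval_eq_sum_weight hsymm'] at h
    simp only [Matrix.mulVec, dotProduct, veronese, Matrix.of_apply, Pi.smul_apply, Pi.one_apply,
      smul_eq_mul, mul_one, a]
    have h' : ((∑ p : UpperIndex d, x k p.1.1 * x k p.1.2 * (weight p * Q p.1.1 p.1.2) : ℤ) : ℝ) =
        l := by
      rw [← h]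
      push_cast
      refine Finset.sum_congr rfl fun p _ => ?_
      simp only [toReal, Matrix.map_apply]
      ring
    exact_mod_cast h'
  have hcramer : (veronese x).det • a = l • ((veronese x).adjugate *ᵥ 1) := by
    rw [← Matrix.mulVec_smul, ← hsys, Matrix.mulVec_mulVec, Matrix.adjugate_mul,
      Matrix.smul_mulVec, Matrix.one_mulVec]
  have hle : ∀ i j : Fin d, i ≤ j → l ∣ 2 * (veronese x).det * Q i j := by
    intro i j hij
    have h : (veronese x).det * (weight ⟨(i, j), hij⟩ * Q i j) = l * _ :=
      congrFun hcramer ⟨(i, j), hij⟩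
    have hd : (veronese x).det * (weight ⟨(i, j), hij⟩ * Q i j) ∣ 2 * (veronese x).det * Q i j := by
      unfold weight
      split_ifs
      · exact ⟨2, by push_cast; ring⟩
      · exact ⟨1, by push_cast; ring⟩
    exact (Dvd.intro _ h.symm).trans hd
  refine hQ.dvd_of_dvd_mul fun i j => ?_
  rcases le_total i j with h | h
  · exact hle i j h
  · rw [← hsymm.apply i j]
    exact hle j i h

open MeasureTheory in
/-- Minkowski's theorem on linear forms. -/
theorem exists_int_ne_zero_abs_mulVec_le {d : ℕ} (hd : d ≠ 0) (B : Matrix (Fin d) (Fin d) ℝ)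
    (hB : B.det ≠ 0) {r : ℝ} (hr : 0 ≤ r) (hrd : |B.det| ≤ r ^ d) :
    ∃ x : Fin d → ℤ, x ≠ 0 ∧ ∀ i, |(B *ᵥ realVec x) i| ≤ r := by
  have : NeZero d := ⟨hd⟩
  let b := Pi.basisFun ℝ (Fin d)
  let L := (Submodule.span ℤ (Set.range b)).toAddSubgroup
  let T : Set (Fin d → ℝ) := Matrix.toLin' B⁻¹ '' Set.Icc (fun _ => -r) (fun _ => r)
  have : Countable L := inferInstanceAs (Countable (Submodule.span ℤ (Set.range b)))
  have : DiscreteTopology L := inferInstanceAs (DiscreteTopology (Submodule.span ℤ (Set.range b)))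
  have hBu : IsUnit B.det := isUnit_iff_ne_zero.2 hB
  have hvol : volume (ZSpan.fundamentalDomain b) * 2 ^ Module.finrank ℝ (Fin d → ℝ) ≤
      volume T := by
    rw [Measure.addHaar_image_linearMap, LinearMap.det_toLin', Matrix.det_nonsing_inv,
      Real.volume_Icc_pi, ZSpan.fundamentalDomain_pi_basisFun, Real.volume_pi_Ico,
      Module.finrank_fin_fun]
    simp only [sub_zero, ENNReal.ofReal_one, Finset.prod_const_one, one_mul, Finset.prod_const,
      Finset.card_univ, Fintype.card_fin, Ring.inverse_eq_inv', abs_inv]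
    rw [← ENNReal.ofReal_pow (by linarith), ← ENNReal.ofReal_mul (by positivity),
      ← ENNReal.ofReal_ofNat, ← ENNReal.ofReal_pow (by norm_num)]
    refine ENNReal.ofReal_le_ofReal ?_
    rw [sub_neg_eq_add, ← two_mul, mul_pow, inv_mul_eq_div, le_div_iff₀ (abs_pos.2 hB)]
    gcongr
  have hT : ∀ y ∈ T, ∀ i, |(B *ᵥ y) i| ≤ r := by
    rintro _ ⟨z, hz, rfl⟩ i
    rw [Matrix.toLin'_apply, Matrix.mulVec_mulVec, Matrix.mul_nonsing_inv _ hBu,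
      Matrix.one_mulVec]
    exact abs_le.2 ⟨hz.1 i, hz.2 i⟩
  obtain ⟨y, hy0, hy⟩ := exists_ne_zero_mem_lattice_of_measure_mul_two_pow_le_measure
    (L := L) (s := T) (μ := volume) (ZSpan.isAddFundamentalDomain b volume) (by
      rintro _ ⟨z, hz, rfl⟩
      refine ⟨-z, ⟨fun i => ?_, fun i => ?_⟩, map_neg _ _⟩
      · exact neg_le_neg (hz.2 i)
      · exact neg_le.1 (hz.1 i))
    ((convex_Icc _ _).linear_image _)
    (isCompact_Icc.image (LinearMap.continuous_of_finiteDimensional _)) hvol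
  have hyL : (y : Fin d → ℝ) ∈ Submodule.span ℤ (Set.range b) := y.2
  rw [b.mem_span_iff_repr_mem ℤ] at hyL
  choose x hx using hyL
  have hxy : realVec x = y := by
    ext i
    simpa [b, realVec] using hx i
  refine ⟨x, ?_, fun i => hxy ▸ hT _ hy i⟩
  rintro rfl
  refine hy0 (Subtype.ext ?_)
  rw [← hxy]
  ext i
  simp [realVec]

/-- Hermite's constant in dimension `d` is at most `d`. -/
theorem arithMin_pow_le {d : ℕ} (hd : d ≠ 0) {B : Matrix (Fin d) (Fin d) ℝ}
    (hQ : (Bᵀ * B).PosDef) : arithMin (Bᵀ * B) ^ d ≤ (d : ℝ) ^ d * B.det ^ 2 := by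
  have hB : B.det ≠ 0 := by
    intro h
    have := hQ.det_pos
    simp [h] at this
  obtain ⟨r, hr, hrd⟩ : ∃ r : ℝ, 0 ≤ r ∧ r ^ d = |B.det| :=
    ⟨|B.det| ^ ((d : ℝ)⁻¹), by positivity, Real.rpow_inv_natCast_pow (abs_nonneg _) hd⟩
  obtain ⟨x, hx0, hx⟩ := exists_int_ne_zero_abs_mulVec_le hd B hB hr hrd.ge
  have hle : arithMin (Bᵀ * B) ≤ d * r ^ 2 := by
    refine (arithMin_le_eval hQ hx0).trans ?_
    rw [eval_transpose_mul_self, dotProduct]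
    refine (Finset.sum_le_card_nsmul _ _ (r ^ 2) fun i _ => ?_).trans_eq (by simp)
    rw [← sq, ← sq_abs]
    exact pow_le_pow_left₀ (abs_nonneg _) (hx i) 2
  have h0 : 0 ≤ arithMin (Bᵀ * B) := arithMin_nonneg hQ
  calc arithMin (Bᵀ * B) ^ d ≤ (d * r ^ 2) ^ d := pow_le_pow_left₀ h0 hle d
    _ = (d : ℝ) ^ d * (r ^ d) ^ 2 := by rw [mul_pow, pow_right_comm]
    _ = _ := by rw [hrd, sq_abs]

theorem det_veronese_minVectors_le {d : ℕ} (hd : d ≠ 0) {Q : Matrix (Fin d) (Fin d) ℝ}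
    (hQ : Q.PosDef) (x : UpperIndex d → Fin d → ℤ) (hx : ∀ k, x k ∈ minVectors Q) :
    ((veronese x).det : ℝ) ^ 2 * 2 ^ (d + 1).choose 2 ≤
      2 ^ d * (d : ℝ) ^ (2 * (d + 1).choose 2) := by
  obtain ⟨s, U, hs, hU, rfl⟩ := exists_diagonal_mul_orthogonal hQ
  set B := Matrix.diagonal s * U with hBdef
  set P := ∏ i, s i with hP
  have hP0 : 0 < P := Finset.prod_pos fun i _ => hs i
  have hdetB : B.det ^ 2 = P ^ 2 := by
    have hU2 : U.det ^ 2 = 1 := by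
      have := congrArg Matrix.det hU
      rwa [Matrix.det_mul, Matrix.det_transpose, Matrix.det_one, ← sq] at this
    rw [hBdef, Matrix.det_mul, Matrix.det_diagonal, mul_pow, hU2, mul_one]
  have hmap : (veronese fun k => realVec (x k)).det = ((veronese x).det : ℝ) := by
    rw [Int.cast_det]
    congr 1
    ext k p
    simp [veronese, realVec]
  have hhad := det_veronese_sq_mul_le fun k => B *ᵥ realVec (x k)
  have hdet : (veronese fun k => B *ᵥ realVec (x k)).det ^ 2 =
      ((veronese x).det : ℝ) ^ 2 * (P ^ (d + 1)) ^ 2 := by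
    simp only [hBdef, ← Matrix.mulVec_mulVec]
    rw [det_veronese_diagonal, mul_pow, det_veronese_orthogonal _ _ hU, hmap]
  simp only [← eval_transpose_mul_self] at hhad
  have hev : ∀ k, eval (Bᵀ * B) (x k) = arithMin (Bᵀ * B) := hx
  simp only [hev] at hhad
  rw [hdet, Finset.prod_const, Finset.card_univ, card_upperIndex] at hhad
  have hW : (∏ p : UpperIndex d, (weight p : ℝ)) * 2 ^ d = 2 ^ (d + 1).choose 2 := by
    exact_mod_cast prod_weight_mul d
  have h2n : d * (d + 1) = 2 * (d + 1).choose 2 := by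
    have := Nat.add_one_mul_choose_eq d 1
    rw [Nat.choose_one_right] at this
    linarith
  have hmin := arithMin_pow_le hd hQ
  have h0 : 0 ≤ arithMin (Bᵀ * B) := arithMin_nonneg hQ
  have hmin' := pow_le_pow_left₀ (pow_nonneg h0 d) hmin (d + 1)
  rw [hdetB, mul_pow, ← pow_mul, ← pow_mul, h2n, pow_mul (arithMin _)] at hmin'
  have hpos : 0 < (P ^ (d + 1)) ^ 2 := by positivity
  refine le_of_mul_le_mul_right ?_ hpos
  calc ((veronese x).det : ℝ) ^ 2 * 2 ^ (d + 1).choose 2 * (P ^ (d + 1)) ^ 2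
      = 2 ^ d * (((veronese x).det : ℝ) ^ 2 * (P ^ (d + 1)) ^ 2 *
          ∏ p : UpperIndex d, (weight p : ℝ)) := by rw [← hW]; ring
    _ ≤ 2 ^ d * ((d : ℝ) ^ (2 * (d + 1).choose 2) * (P ^ 2) ^ (d + 1)) :=
        mul_le_mul_of_nonneg_left (hhad.trans hmin') (by positivity)
    _ = _ := by ring

theorem eval_toReal_eq_intCast {d : ℕ} (Q : Matrix (Fin d) (Fin d) ℤ) (x : Fin d → ℤ) :
    eval (toReal Q) x = ((x ⬝ᵥ (Q *ᵥ x) : ℤ) : ℝ) := by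
  simp [eval, toReal, dotProduct, Matrix.mulVec]

theorem arithMin_sq_mul_le {d : ℕ} (hd : d ≠ 0) {Q : Matrix (Fin d) (Fin d) ℤ}
    (hprim : IsPrimitive Q) (hperf : IsPerfect (toReal Q)) :
    arithMin (toReal Q) ^ 2 * 2 ^ (d + 1).choose 2 ≤
      2 ^ (d + 2) * (d : ℝ) ^ (2 * (d + 1).choose 2) := by
  obtain ⟨x, hx, hdet⟩ := hperf.exists_det_veronese_ne_zero
  have hsymm : Q.IsSymm := by
    ext i j
    simpa [toReal] using hperf.1.isHermitian.apply i j
  let i₀ : Fin d := ⟨0, Nat.pos_of_ne_zero hd⟩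
  let k₀ : UpperIndex d := ⟨(i₀, i₀), le_rfl⟩
  obtain ⟨l, hl⟩ : ∃ l : ℤ, arithMin (toReal Q) = l :=
    ⟨_, (hx k₀).symm.trans (eval_toReal_eq_intCast Q (x k₀))⟩
  have hdvd : l ∣ 2 * (veronese x).det :=
    hprim.dvd_two_mul_det_veronese hsymm x fun k => (hx k).trans hl
  have hlD : l ^ 2 ≤ (2 * (veronese x).det) ^ 2 :=
    sq_le_sq.2 (by
      rw [Int.abs_eq_natAbs, Int.abs_eq_natAbs]
      exact_mod_cast Nat.le_of_dvd (Int.natAbs_pos.2 (mul_ne_zero two_ne_zero hdet))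
        (Int.natAbs_dvd_natAbs.2 hdvd))
  have hlD' : (l : ℝ) ^ 2 ≤ (2 * ((veronese x).det : ℝ)) ^ 2 := by exact_mod_cast hlD
  have hD := det_veronese_minVectors_le hd hperf.1 x hx
  rw [hl]
  calc (l : ℝ) ^ 2 * 2 ^ (d + 1).choose 2
      ≤ (2 * ((veronese x).det : ℝ)) ^ 2 * 2 ^ (d + 1).choose 2 := by gcongr
    _ = 4 * (((veronese x).det : ℝ) ^ 2 * 2 ^ (d + 1).choose 2) := by ring
    _ ≤ 4 * (2 ^ d * (d : ℝ) ^ (2 * (d + 1).choose 2)) := by gcongr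
    _ = _ := by ring

theorem arithMin_sq_mul_two_pow_le {d : ℕ} {Q : Matrix (Fin d) (Fin d) ℤ}
    (hprim : IsPrimitive Q) (hperf : IsPerfect (toReal Q)) :
    arithMin (toReal Q) ^ 2 * 2 ^ (2 * (d + 1).choose 2 + d) ≤
      ((d : ℝ) ^ 3 * ((d : ℝ) + 7)) ^ (d + 1).choose 2 := by
  rcases Nat.lt_or_ge d 2 with hd | hd
  · interval_cases d
    · exact absurd (hprim 0 fun i => i.elim0) not_isUnit_zero
    · have hunit : IsUnit (Q 0 0) := hprim _ fun i j => by
        rw [Subsingleton.elim i 0, Subsingleton.elim j 0]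
      have hev : eval (toReal Q) 1 = Q 0 0 := by
        simp [eval_toReal_eq_intCast, dotProduct, Matrix.mulVec]
      have hle : arithMin (toReal Q) ≤ Q 0 0 := hev ▸ arithMin_le_eval hperf.1 one_ne_zero
      have h0 : 0 ≤ arithMin (toReal Q) := arithMin_nonneg hperf.1
      have hsq : ((Q 0 0 : ℤ) : ℝ) ^ 2 = 1 := by
        rcases Int.isUnit_iff.1 hunit with h | h <;> simp [h]
      have := pow_le_pow_left₀ h0 hle 2
      rw [hsq] at this
      norm_num [-sq_le_one_iff_abs_le_one]
      linarith
  · set n := (d + 1).choose 2 with hn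
    have h2n : d * (d + 1) = 2 * n := by
      have := Nat.add_one_mul_choose_eq d 1
      rw [Nat.choose_one_right] at this
      linarith
    have hexp : n + 2 * d + 2 ≤ 4 * n := by nlinarith
    have hbase : (2 : ℝ) ^ (n + 2 * d + 2) ≤ ((d : ℝ) * (d + 7)) ^ n := by
      have hd' : (2 : ℝ) ≤ d := by exact_mod_cast hd
      calc (2 : ℝ) ^ (n + 2 * d + 2) ≤ 2 ^ (4 * n) := pow_le_pow_right₀ one_le_two hexp
        _ = (2 ^ 4) ^ n := pow_mul _ _ _
        _ ≤ _ := pow_le_pow_left₀ (by positivity) (by nlinarith) n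
    have h := arithMin_sq_mul_le (by lia) hprim hperf
    rw [← hn] at h
    calc arithMin (toReal Q) ^ 2 * 2 ^ (2 * n + d)
        = arithMin (toReal Q) ^ 2 * 2 ^ n * 2 ^ (n + d) := by ring
      _ ≤ 2 ^ (d + 2) * (d : ℝ) ^ (2 * n) * 2 ^ (n + d) := by gcongr
      _ = (d : ℝ) ^ (2 * n) * 2 ^ (n + 2 * d + 2) := by ring
      _ ≤ (d : ℝ) ^ (2 * n) * ((d : ℝ) * (d + 7)) ^ n := by gcongr
      _ = _ := by rw [pow_mul, ← mul_pow]; ring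

end PerfectForm

/-- The arithmetical minimum of a primitive integral perfect form of dimension `d` is at most
`2^{-(n + d/2)} (d³(d+7))^{n/2}`, where `n = binom(d+1, 2)`. -/
theorem mainTheorem2 (d n : ℕ) (hn : n = (d + 1).choose 2)
    (Q : Matrix (Fin d) (Fin d) ℤ)
    (hprim : PerfectForm.IsPrimitive Q)
    (hperf : PerfectForm.IsPerfect (PerfectForm.toReal Q)) :
    PerfectForm.arithMin (PerfectForm.toReal Q) ≤
      (2 : ℝ) ^ (-((n : ℝ) + (d : ℝ) / 2)) *
        ((d : ℝ) ^ 3 * ((d : ℝ) + 7)) ^ ((n : ℝ) / 2) := by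
  have h := PerfectForm.arithMin_sq_mul_two_pow_le hprim hperf
  rw [← hn] at h
  refine le_of_sq_le_sq ?_ (by positivity)
  have h1 : ((2 : ℝ) ^ (-((n : ℝ) + (d : ℝ) / 2))) ^ 2 = (2 ^ (2 * n + d))⁻¹ := by
    rw [← Real.rpow_mul_natCast two_pos.le, ← Real.rpow_natCast, ← Real.rpow_neg two_pos.le]
    congr 1
    push_cast
    ring
  have h2 : (((d : ℝ) ^ 3 * ((d : ℝ) + 7)) ^ ((n : ℝ) / 2)) ^ 2 =
      ((d : ℝ) ^ 3 * ((d : ℝ) + 7)) ^ n := by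
    rw [← Real.rpow_mul_natCast (by positivity), ← Real.rpow_natCast _ n]
    congr 1
    push_cast
    ring
  rw [mul_pow, h1, h2, inv_mul_eq_div, le_div_iff₀ (by positivity)]
  exact h
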